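/- Let $\mathcal M=(\mathcal M_\lambda)_\lambda$ be a family of non-empty finite sets of bit strings (the message space). A UE scheme consists of a key generation algorithm $\mathsf{KG}(1^\lambda)\to(\mathsf{ek},\mathsf{dk})$, an encryption algorithm $\mathsf{Enc}(\mathsf{ek},\mathsf m)\to\mathsf{ct}$ and a decryption algorithm $\mathsf{Dec}(\mathsf{dk},\mathsf{ct})\to\mathsf m'$, all quantum polynomial-time (QPT, with the security parameter $1^\lambda$ as an additional input), such that $\Pr[\mathsf{Dec}(\mathsf{dk},\mathsf{ct})=\mathsf m]\ge 1-\mathsf{negl}(\lambda)$ for all $\mathsf m\in\mathcal M_\lambda$. It is assumed that $\mathsf{Enc}$ has classically determined outputs: it takes a classical input and classical randomness and outputs a pure state (which may include a classical string) fully determined by them. The scheme is multi-copy search secure if every QPT adversary $(\mathcal A_0,\mathcal A_1,\dots,\mathcal A_{q+1})$ wins the following experiment with probability at most $1/|\mathcal M_\lambda|+\mathsf{negl}(\lambda)$. The challenger generates $(\mathsf{ek},\mathsf{dk})\leftarrow\mathsf{KG}(1^\lambda)$; $\mathcal A_0$, on input $1^\lambda$, chooses $1^q$; the challenger samples a uniformly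 random $\mathsf m\in\mathcal M_\lambda$ and gives $\mathcal A_0$ exactly $q$ copies of one ciphertext state $\mathsf{ct}$ of $\mathsf m$ under $\mathsf{ek}$, all generated with the same encryption randomness; $\mathcal A_0$ prepares a $(q+1)$-partite state and gives its $i$-th register to $\mathcal A_i$; every $\mathcal A_i$ also receives $\mathsf{dk}$ and, without communication, outputs $\mathsf m_i'$. The adversary wins if $\mathsf m_i'=\mathsf m$ for all $i\in\{1,\dots,q+1\}$. Theorem. Suppose there is a multi-copy search secure UE scheme with message space $\mathcal M$ whose key generation algorithm is classical, i.e. a classical probabilistic polynomial-time algorithm. Then there is a multi-copy search secure UE scheme with the same message space $\mathcal M$ (and again with classical key generation) whose encryption and decryption keys are identical, $\mathsf{ek}=\mathsf{dk}$. -/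

import Mathlib

/-! Unclonable encryption with uniform quantum polynomial-time algorithms.

A (hybrid) quantum polynomial-time algorithm is given by deterministic classical polynomial-time
procedures which, from the classical inputs, print a quantum circuit over the gates `H`, `T`,
`CNOT`; the circuit is run on the quantum input and on fresh qubits in state zero, some qubits are
measured, and the outcome is post-processed by a classical polynomial-time procedure.
The classical procedures are programs of a multi-stack machine with a step count. -/

noncomputable section

namespace UnclonableEnc

/-! ### Classical polynomial time -/

/-- Structured programs of a machine with finitely many stacks of bits (named by naturals). -/
inductive Prog : Type
  | skip : Prog
  | push (x : ℕ) (b : Bool) : Prog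
  | pop (x : ℕ) : Prog
  | seq (p q : Prog) : Prog
  /-- Run `p` if the top of stack `x` is `true`, otherwise (also if `x` is empty) run `q`. -/
  | ifTop (x : ℕ) (p q : Prog) : Prog
  /-- While stack `x` is non-empty, run `p`. -/
  | loop (x : ℕ) (p : Prog) : Prog

/-- The contents of all the stacks; the head of the list is the top of the stack. -/
abbrev Store : Type := ℕ → List Bool

/-- `Exec p s t s'`: started on `s`, the program `p` halts after `t` steps with contents `s'`. -/
inductive Exec : Prog → Store → ℕ → Store → Prop
  | skip (s : Store) : Exec Prog.skip s 1 s
  | push (x : ℕ) (b : Bool) (s : Store) :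
      Exec (Prog.push x b) s 1 (Function.update s x (b :: s x))
  | pop (x : ℕ) (s : Store) : Exec (Prog.pop x) s 1 (Function.update s x (s x).tail)
  | seq {p q : Prog} {s s' s'' : Store} {t t' : ℕ} :
      Exec p s t s' → Exec q s' t' s'' → Exec (Prog.seq p q) s (t + t') s''
  | ifTrue {x : ℕ} {p q : Prog} {s s' : Store} {t : ℕ} :
      (s x).head? = some true → Exec p s t s' → Exec (Prog.ifTop x p q) s (t + 1) s'
  | ifFalse {x : ℕ} {p q : Prog} {s s' : Store} {t : ℕ} :
      (s x).head? ≠ some true → Exec q s t s' → Exec (Prog.ifTop x p q) s (t + 1) s'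
  | loopDone {x : ℕ} {p : Prog} {s : Store} : s x = [] → Exec (Prog.loop x p) s 1 s
  | loopStep {x : ℕ} {p : Prog} {s s' s'' : Store} {t t' : ℕ} :
      s x ≠ [] → Exec p s t s' → Exec (Prog.loop x p) s' t' s'' →
      Exec (Prog.loop x p) s (t + t' + 1) s''

/-- The `k` inputs are on the stacks `0, …, k - 1`, all the other stacks are empty. -/
def inputStore {k : ℕ} (x : Fin k → List Bool) : Store :=
  fun i => if h : i < k then x ⟨i, h⟩ else []

/-- A function of `k` bit strings is polynomial-time computable if some program leaves its value on
stack `0` after a number of steps that is at most a polynomial in the total input length. -/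
def PolyTime {k : ℕ} (f : (Fin k → List Bool) → List Bool) : Prop :=
  ∃ (p : Prog) (b : Polynomial ℕ), ∀ x : Fin k → List Bool, ∃ (t : ℕ) (s : Store),
    Exec p (inputStore x) t s ∧ t ≤ b.eval (∑ i, (x i).length) ∧ s 0 = f x

/-- The polynomial-time computable functions of `k` bit strings. -/
structure PolyFun (k : ℕ) : Type where
  toFun : (Fin k → List Bool) → List Bool
  polyTime : PolyTime toFun

instance (k : ℕ) : CoeFun (PolyFun k) (fun _ => (Fin k → List Bool) → List Bool) :=
  ⟨PolyFun.toFun⟩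

/-- The number `n` in unary. -/
def unary (n : ℕ) : List Bool := List.replicate n true

/-! ### Quantum circuits -/

/-- The gates, on wires labelled by `W`. -/
inductive Gate (W : Type) : Type
  | H (w : W) : Gate W
  | T (w : W) : Gate W
  | CNOT (c t : W) : Gate W

/-- Relabelling of the wires of a gate. -/
def Gate.map {V W : Type} (f : V → W) : Gate V → Gate W
  | .H w => .H (f w)
  | .T w => .T (f w)
  | .CNOT c t => .CNOT (f c) (f t)

/-- A circuit: a list of gates, applied from left to right. -/
abbrev Circuit (W : Type) : Type := List (Gate W)

/-- Relabelling of the wires of a circuit. -/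
def Circuit.map {V W : Type} (f : V → W) (C : Circuit V) : Circuit W :=
  List.map (Gate.map f) C

/-- A pure state of qubits labelled by `W`, of which all but finitely many are in state zero.
`ψ S` is the amplitude of the basis state in which exactly the qubits in `S` are one. -/
abbrev QState (W : Type) : Type := Finset W → ℂ

/-- The state in which all the qubits are zero. -/
def zeroState (W : Type) [DecidableEq W] : QState W := fun S => if S = ∅ then 1 else 0

/-- The action of a gate. A `CNOT` whose control and target coincide is not a gate; it does
nothing. -/
def Gate.act {W : Type} [DecidableEq W] : Gate W → QState W → QState W
  | .H w, ψ => fun S =>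
      ((Real.sqrt 2 : ℝ) : ℂ)⁻¹ *
        (ψ (S.erase w) + (if w ∈ S then -1 else 1) * ψ (insert w S))
  | .T w, ψ => fun S =>
      if w ∈ S then Complex.exp (Complex.I * (Real.pi / 4 : ℝ)) * ψ S else ψ S
  | .CNOT c t, ψ => fun S =>
      if c ≠ t ∧ c ∈ S then ψ (symmDiff S {t}) else ψ S

/-- The action of a circuit. -/
def Circuit.act {W : Type} [DecidableEq W] (C : Circuit W) (ψ : QState W) : QState W :=
  C.foldl (fun φ g => g.act φ) ψ

/-- The probability of the event `E` when all the qubits of `ψ` are measured in the computational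
basis (`ψ` may be subnormalized). -/
def bornProb {W : Type} (ψ : QState W) (E : Finset W → Prop) : ℝ :=
  open Classical in ∑' S : Finset W, if E S then ‖ψ S‖ ^ 2 else 0

/-- Reads a bit string as a list of numbers in unary, each of them terminated by `false`. -/
def readNumbers : ℕ → List Bool → List ℕ
  | _, [] => []
  | n, true :: l => readNumbers (n + 1) l
  | n, false :: l => n :: readNumbers 0 l

/-- Reads a list of numbers as a circuit, five numbers for each gate: the kind of the gate and two
wires. -/
def readGates : List ℕ → Circuit (ℕ × ℕ)
  | k :: a :: b :: c :: d :: l =>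
      (match k with
        | 0 => Gate.H (a, b)
        | 1 => Gate.T (a, b)
        | _ => Gate.CNOT (a, b) (c, d)) :: readGates l
  | _ => []

/-- The circuit described by a bit string. Its wires are arranged in banks: `(a, j)` is wire `j` of
bank `a`. -/
def readCircuit (l : List Bool) : Circuit (ℕ × ℕ) := readGates (readNumbers 0 l)

/-! ### Quantum polynomial-time algorithms -/

/-- A quantum polynomial-time algorithm with `k` classical inputs `x`, a quantum input and a
classical output. It runs the circuit described by `circ x`, with the quantum input in bank `0` and
a workspace of zero qubits in the other banks. Then it measures the first `(meas x).length` qubits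
of bank `0` and outputs `post (y, x)`, where `y` is the outcome. -/
structure QAlg (k : ℕ) : Type where
  circ : PolyFun k
  meas : PolyFun k
  post : PolyFun (k + 1)

/-- The qubits that occur in the experiments: the banks, which are passed between the algorithms
(or stay with the algorithm that uses them), and the private workspaces of the runs of the
encryption algorithm and of the parties. -/
inductive Wire : Type
  | bank (i j : ℕ) : Wire
  | encWork (k a j : ℕ) : Wire
  | work (i a j : ℕ) : Wire
  deriving DecidableEq

/-- The wires of a run of the encryption algorithm which outputs into bank `k`. -/
def encWire (k : ℕ) : ℕ × ℕ → Wire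
  | (0, j) => .bank k j
  | (a + 1, j) => .encWork k a j

/-- The wires of a run of an algorithm by a party which holds bank `i`. -/
def partyWire (i : ℕ) : ℕ × ℕ → Wire
  | (0, j) => .bank i j
  | (a + 1, j) => .work i a j

/-- The wires of an algorithm which holds all the banks. -/
def bankWire : ℕ × ℕ → Wire
  | (i, j) => .bank i j

/-- The values of the first `n` qubits of bank `i` in the basis state `S`. -/
def readBank (i n : ℕ) (S : Finset Wire) : List Bool :=
  List.ofFn (fun j : Fin n => decide (Wire.bank i j ∈ S))

/-- The circuit run by `A` on the classical inputs `x`, by the party which holds bank `i`. -/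
def QAlg.circuit {k : ℕ} (A : QAlg k) (x : Fin k → List Bool) (i : ℕ) : Circuit Wire :=
  (readCircuit (A.circ x)).map (partyWire i)

/-- The output of `A`, in the branch in which the final measurement finds the basis state `S`. -/
def QAlg.output {k : ℕ} (A : QAlg k) (x : Fin k → List Bool) (i : ℕ) (S : Finset Wire) :
    List Bool :=
  A.post (Matrix.vecCons (readBank i (A.meas x).length S) x)

/-! ### Expectations and negligible functions -/

/-- The expectation of `f r` for a uniformly random bit string `r` of length `n`. -/
def avgBits (n : ℕ) (f : List Bool → ℝ) : ℝ := (∑ r : Fin n → Bool, f (List.ofFn r)) / 2 ^ n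

/-- The expectation of `f m` for a uniformly random element `m` of `M`. -/
def avgOver (M : Finset (List Bool)) (f : List Bool → ℝ) : ℝ := (∑ m ∈ M, f m) / M.card

/-- Negligible functions of the security parameter. -/
def Negligible (ν : ℕ → ℝ) : Prop :=
  Asymptotics.SuperpolynomialDecay Filter.atTop (fun n : ℕ => (n : ℝ)) ν

/-! ### Unclonable encryption -/

/-- The algorithms of an unclonable encryption scheme with a classical key generation algorithm.
* Key generation is a classical probabilistic polynomial-time algorithm: with security parameter `n`
  and uniformly random `r` of length `kgCoins n`, the keys are `ek (1ⁿ, r)` and `dk (1ⁿ, r)`.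
* Encryption, on `x = (1ⁿ, ek, m, r)` with uniformly random `r` of length `encCoins n`, outputs the
  classical string `encStr x` and the qubits in bank `0` of the circuit `encCirc x` run on zeros.
* Decryption has the classical inputs `1ⁿ`, `dk`, and the classical part of the ciphertext, and the
  quantum part of the ciphertext as its quantum input. (Outputs that are not messages stand for the
  failure symbol.) -/
structure UEScheme : Type where
  kgCoins : Polynomial ℕ
  ek : PolyFun 2
  dk : PolyFun 2
  encCoins : Polynomial ℕ
  encStr : PolyFun 4
  encCirc : PolyFun 4
  dec : QAlg 3

namespace UEScheme

variable (U : UEScheme)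

/-- The circuit of the encryption algorithm, with output in bank `k`. -/
def encCircuit (x : Fin 4 → List Bool) (k : ℕ) : Circuit Wire :=
  (readCircuit (U.encCirc x)).map (encWire k)

/-- The encryption algorithm has classically determined outputs: for each key, message and
randomness, the output qubits (bank `0`) are in a pure state, that is, in a product state with the
remaining qubits, which are discarded. -/
def EncClassicallyDetermined (M : ℕ → Finset (List Bool)) : Prop :=
  ∀ (n : ℕ) (r m r' : List Bool), r.length = U.kgCoins.eval n → m ∈ M n →
    r'.length = U.encCoins.eval n →
    ∃ φ χ : QState (ℕ × ℕ), ∀ S : Finset (ℕ × ℕ),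
      (readCircuit (U.encCirc ![unary n, U.ek ![unary n, r], m, r'])).act (zeroState (ℕ × ℕ)) S =
        φ (S.filter (fun w => w.1 = 0)) * χ (S.filter (fun w => w.1 ≠ 0))

/-- The probability that the decryption of an encryption of `m` under fresh keys is `m`. -/
def decProb (n : ℕ) (m : List Bool) : ℝ :=
  avgBits (U.kgCoins.eval n) fun r =>
  avgBits (U.encCoins.eval n) fun r' =>
    let x := ![unary n, U.ek ![unary n, r], m, r']
    let z := ![unary n, U.dk ![unary n, r], U.encStr x]
    bornProb ((U.encCircuit x 1 ++ U.dec.circuit z 1).act (zeroState Wire))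
      (fun S => U.dec.output z 1 S = m)

/-- Decryption correctness. -/
def Correct (M : ℕ → Finset (List Bool)) : Prop :=
  ∃ ν : ℕ → ℝ, Negligible ν ∧ ∀ (n : ℕ), ∀ m ∈ M n, 1 - ν n ≤ U.decProb n m

end UEScheme

/-- An adversary `(A₀, A₁, …, A_{q+1})` against multi-copy search security.
* `A₀` has random coins `u` of length `coins n`. It first runs `start` on `(1ⁿ, u)`, obtains `o`,
  and asks for `q` ciphertexts, where `q` is the length of `copies (1ⁿ, u, o)`; the qubits
  left in bank `0` are kept. Then it receives the classical part `c` of the ciphertext, and the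
  quantum parts of the `q` copies in the banks `1, …, q`. It runs the circuit described by
  `splitCirc (1ⁿ, u, o, c)` on all the banks. The register of `Aᵢ` consists of bank `i` and of
  the classical string `splitStr (1ⁿ, u, o, c)`.
* `Aᵢ` runs `guess` on its register with the classical inputs `1ⁿ`, `1ⁱ`, `dk`, and the classical
  part of the register. -/
structure Adversary : Type where
  coins : Polynomial ℕ
  start : QAlg 2
  copies : PolyFun 3
  splitCirc : PolyFun 4
  splitStr : PolyFun 4
  guess : QAlg 4

namespace UEScheme

variable (U : UEScheme)

/-- The probability that the experiment outputs `1` for security parameter `n`, if the keys are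
generated with randomness `r`, the message is `m`, all the copies of the ciphertext are generated
with the same randomness `r'`, and the coins of the adversary are `u`. The sum is over the outcomes
`y` of the measurement by which `A₀` determines the number of copies. -/
def runProb (A : Adversary) (n : ℕ) (r m r' u : List Bool) : ℝ :=
  let x := ![unary n, U.ek ![unary n, r], m, r']
  let x₀ := ![unary n, u]
  let L := (A.start.meas x₀).length
  ∑ y : Fin L → Bool,
    let o := A.start.post (Matrix.vecCons (List.ofFn y) x₀)
    let q := (A.copies ![unary n, u, o]).length
    -- without any copy, the adversary does not get the classical part either
    let c := if q = 0 then [] else U.encStr x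
    let z := ![unary n, u, o, c]
    let xg : ℕ → Fin 4 → List Bool :=
      fun i => ![unary n, unary i, U.dk ![unary n, r], A.splitStr z]
    let ψ₀ : QState Wire := (A.start.circuit x₀ 0).act (zeroState Wire)
    let ψ₁ : QState Wire := fun S => if readBank 0 L S = List.ofFn y then ψ₀ S else 0
    let C : Circuit Wire :=
      (List.range q).flatMap (fun k => U.encCircuit x (k + 1)) ++
      ((readCircuit (A.splitCirc z)).map bankWire ++
      (List.range (q + 1)).flatMap (fun i => A.guess.circuit (xg (i + 1)) (i + 1)))
    bornProb (C.act ψ₁) (fun S => ∀ i < q + 1, A.guess.output (xg (i + 1)) (i + 1) S = m)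

/-- The probability that the multi-copy search experiment outputs `1`. -/
def advantage (M : ℕ → Finset (List Bool)) (A : Adversary) (n : ℕ) : ℝ :=
  avgBits (U.kgCoins.eval n) fun r =>
  avgOver (M n) fun m =>
  avgBits (U.encCoins.eval n) fun r' =>
  avgBits (A.coins.eval n) fun u =>
    U.runProb A n r m r' u

/-- Multi-copy search security. -/
def MultiCopySearchSecure (M : ℕ → Finset (List Bool)) : Prop :=
  ∀ A : Adversary, ∃ ν : ℕ → ℝ, Negligible ν ∧
    ∀ n : ℕ, U.advantage M A n ≤ 1 / (M n).card + ν n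

/-- The encryption key and the decryption key are identical. -/
def IdenticalKeys : Prop :=
  ∀ (n : ℕ) (r : List Bool), r.length = U.kgCoins.eval n →
    U.ek ![unary n, r] = U.dk ![unary n, r]

/-- `U` is an unclonable encryption scheme with message space `M`, whose encryption algorithm has
classically determined outputs. -/
structure IsUE (M : ℕ → Finset (List Bool)) : Prop where
  correct : U.Correct M
  classicallyDetermined : U.EncClassicallyDetermined M

end UEScheme

end UnclonableEnc

end

noncomputable section

namespace UnclonableEnc

/-! ### Programs -/

/-! The new key is a uniformly random one-time pad `s`. Encryption generates fresh keys of `U` from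
its own coins, encrypts the message under them, and appends the decryption key masked by `s`. Since
key generation is classical, both the keys and the masked key are classical strings determined by
the coins, so outputs stay classically determined and all copies made with the same coins share one
key pair and one masked key.

Security is an exact identity of winning probabilities. The reduction replaces the masked key by a
uniform string `p` taken from its own coins. Only the parties of the last stage need the pad, and
they then hold the decryption key `d` of `U`, so they compute the pad as `p` plus the encoding of
`d`. For fixed `d`, passing between pad and masked key is a bijection (`avgBits_mask`), so the
simulation is perfect: `otp_runProb` matches the runs and `otp_advantage` averages them. The length
of the pad matters only for correctness (`exists_padLength`, `otp_decProb`).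

The rest shows that these constructions are polynomial-time on the stack machine; the main tool is
closure under composition, `PolyTime.comp`. -/

/-- Started on `s`, the program `p` halts with contents `s'` after at most `T` steps. -/
def Runs (p : Prog) (s : Store) (T : ℕ) (s' : Store) : Prop := ∃ t ≤ T, Exec p s t s'

namespace Runs

variable {p q : Prog} {s s' s'' : Store} {T T' : ℕ} {x y : ℕ}

lemma mono (h : Runs p s T s') (hT : T ≤ T') : Runs p s T' s' := by
  obtain ⟨t, ht, h⟩ := h
  exact ⟨t, ht.trans hT, h⟩

lemma cast (h : Runs p s T s') (hs : s' = s'') (hT : T ≤ T') : Runs p s T' s'' := hs ▸ h.mono hT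

lemma skip : Runs .skip s 1 s := ⟨1, le_rfl, .skip s⟩

lemma push (x : ℕ) (b : Bool) (s : Store) :
    Runs (.push x b) s 1 (Function.update s x (b :: s x)) := ⟨1, le_rfl, .push x b s⟩

lemma pop (x : ℕ) (s : Store) : Runs (.pop x) s 1 (Function.update s x (s x).tail) :=
  ⟨1, le_rfl, .pop x s⟩

lemma seq (h : Runs p s T s') (h' : Runs q s' T' s'') : Runs (.seq p q) s (T + T') s'' := by
  obtain ⟨t, ht, h⟩ := h
  obtain ⟨t', ht', h'⟩ := h'
  exact ⟨t + t', by omega, h.seq h'⟩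

lemma ifTop (hp : (s x).head? = some true → Runs p s T s')
    (hq : (s x).head? ≠ some true → Runs q s T s') : Runs (.ifTop x p q) s (T + 1) s' := by
  by_cases h : (s x).head? = some true
  · obtain ⟨t, ht, e⟩ := hp h
    exact ⟨t + 1, by omega, .ifTrue h e⟩
  · obtain ⟨t, ht, e⟩ := hq h
    exact ⟨t + 1, by omega, .ifFalse h e⟩

lemma loopDone (h : s x = []) : Runs (.loop x p) s 1 s := ⟨1, le_rfl, .loopDone h⟩

lemma loopStep (h : s x ≠ []) (hp : Runs p s T s') (hl : Runs (.loop x p) s' T' s'') :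
    Runs (.loop x p) s (T + T' + 1) s'' := by
  obtain ⟨t, ht, e⟩ := hp
  obtain ⟨t', ht', e'⟩ := hl
  exact ⟨t + t' + 1, by omega, .loopStep h e e'⟩

/-- A step pushes at most one bit. Time bounds therefore bound output lengths, which composition
needs. -/
lemma length_le (h : Runs p s T s') (x : ℕ) : (s' x).length ≤ (s x).length + T := by
  obtain ⟨t, ht, e⟩ := h
  suffices (s' x).length ≤ (s x).length + t by omega
  clear ht
  induction e with
  | skip s => omega
  | push y b s =>
    by_cases hxy : x = y
    · subst hxy; simp
    · simp [Function.update_of_ne hxy]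
  | pop y s =>
    by_cases hxy : x = y
    · subst hxy; simp; omega
    · simp [Function.update_of_ne hxy]
  | seq _ _ _ _ => omega
  | ifTrue _ _ _ => omega
  | ifFalse _ _ _ => omega
  | loopDone _ => omega
  | loopStep _ _ _ _ _ => omega

end Runs

namespace Prog

/-- Relabelling of the stacks of a program. -/
def map (σ : ℕ → ℕ) : Prog → Prog
  | skip => skip
  | push x b => push (σ x) b
  | pop x => pop (σ x)
  | seq p q => seq (p.map σ) (q.map σ)
  | ifTop x p q => ifTop (σ x) (p.map σ) (q.map σ)
  | loop x p => loop (σ x) (p.map σ)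

/-- Empty the stack `x`. -/
def clear (x : ℕ) : Prog := loop x (pop x)

/-- Push the top of `x` (`false` if `x` is empty) to `y`. -/
def pushTop (x y : ℕ) : Prog := ifTop x (push y true) (push y false)

/-- Move the stack `x` to `y`, reversing the order. -/
def revMove (x y : ℕ) : Prog := loop x (seq (pushTop x y) (pop x))

/-- Move the stack `x` to `y`, using the empty stack `z`. -/
def move (x y z : ℕ) : Prog := seq (revMove x z) (revMove z y)

/-- Copy the stack `x` to `y`, using the empty stack `z`. -/
def copy (x y z : ℕ) : Prog :=
  seq (revMove x z) (loop z (seq (pushTop z x) (seq (pushTop z y) (pop z))))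

end Prog

/-- Lets a subroutine run on its own family of stacks: it sees the big store only through `σ`, and
everything outside the range of `σ` survives. -/
lemma Exec.map {σ : ℕ → ℕ} (hσ : σ.Injective) {p : Prog} {s s' : Store} {t : ℕ}
    (h : Exec p s t s') : ∀ S : Store, (∀ j, S (σ j) = s j) →
      ∃ S', Exec (p.map σ) S t S' ∧ (∀ j, S' (σ j) = s' j) ∧
        ∀ i, (∀ j, i ≠ σ j) → S' i = S i := by
  have upd : ∀ (S s : Store) (x : ℕ) (l l' : List Bool), (∀ j, S (σ j) = s j) → l = l' →
      (∀ j, Function.update S (σ x) l (σ j) = Function.update s x l' j) ∧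
        ∀ i, (∀ j, i ≠ σ j) → Function.update S (σ x) l i = S i := by
    intro S s x l l' hS hl
    refine ⟨fun j => ?_, fun i hi => Function.update_of_ne (hi x) _ _⟩
    by_cases hj : j = x
    · subst hj; simp [hl]
    · rw [Function.update_of_ne hj, Function.update_of_ne (fun e => hj (hσ e)), hS]
  induction h with
  | skip s => exact fun S hS => ⟨S, .skip S, hS, fun _ _ => rfl⟩
  | push x b s =>
    exact fun S hS => ⟨_, .push (σ x) b S, upd S s x _ _ hS (by rw [hS])⟩
  | pop x s =>
    exact fun S hS => ⟨_, .pop (σ x) S, upd S s x _ _ hS (by rw [hS])⟩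
  | seq _ _ ih₁ ih₂ =>
    intro S hS
    obtain ⟨S', e, h, k⟩ := ih₁ S hS
    obtain ⟨S'', e', h', k'⟩ := ih₂ S' h
    exact ⟨S'', .seq e e', h', fun i hi => (k' i hi).trans (k i hi)⟩
  | ifTrue hx _ ih =>
    intro S hS
    obtain ⟨S', e, h, k⟩ := ih S hS
    exact ⟨S', .ifTrue (by rwa [hS]) e, h, k⟩
  | ifFalse hx _ ih =>
    intro S hS
    obtain ⟨S', e, h, k⟩ := ih S hS
    exact ⟨S', .ifFalse (by rwa [hS]) e, h, k⟩
  | loopDone hx => exact fun S hS => ⟨S, .loopDone (by rwa [hS]), hS, fun _ _ => rfl⟩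
  | loopStep hx _ _ ih₁ ih₂ =>
    intro S hS
    obtain ⟨S', e, h, k⟩ := ih₁ S hS
    obtain ⟨S'', e', h', k'⟩ := ih₂ S' h
    exact ⟨S'', .loopStep (by rwa [hS]) e e', h', fun i hi => (k' i hi).trans (k i hi)⟩

namespace Runs

lemma map {σ : ℕ → ℕ} (hσ : σ.Injective) {p : Prog} {s s' S : Store} {T : ℕ}
    (h : Runs p s T s') (hS : ∀ j, S (σ j) = s j) :
    ∃ S', Runs (p.map σ) S T S' ∧ (∀ j, S' (σ j) = s' j) ∧ ∀ i, (∀ j, i ≠ σ j) → S' i = S i := by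
  obtain ⟨t, ht, e⟩ := h
  obtain ⟨S', e', h⟩ := e.map hσ S hS
  exact ⟨S', ⟨t, ht, e'⟩, h⟩

lemma clear (x : ℕ) (s : Store) :
    Runs (.clear x) s (2 * (s x).length + 1) (Function.update s x []) := by
  generalize hl : s x = l
  induction l generalizing s with
  | nil => exact (loopDone hl).cast (by simp [← hl]) (by simp)
  | cons b l ih =>
    exact (loopStep (by simp [hl]) (pop x s) (ih _ (by simp [hl]))).cast (by simp)
      (by simp; omega)

lemma pushTop (x y : ℕ) (s : Store) :
    Runs (.pushTop x y) s 2 (Function.update s y ((s x).headD false :: s y)) := by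
  refine ifTop (fun h => ?_) (fun h => ?_)
  · convert push y true s
    cases hs : s x <;> simp_all
  · convert push y false s
    cases hs : s x <;> simp_all

lemma revMove {x y : ℕ} (hxy : x ≠ y) (s : Store) :
    Runs (.revMove x y) s (4 * (s x).length + 1)
      (Function.update (Function.update s x []) y ((s x).reverse ++ s y)) := by
  generalize hl : s x = l
  induction l generalizing s with
  | nil =>
    have := Function.update_eq_self x s
    exact (loopDone hl).cast (by rw [hl] at this; simp [this]) (by simp)
  | cons b l ih =>
    refine (loopStep (by simp [hl]) ((pushTop x y s).seq (pop x _)) (ih _ ?_)).cast ?_ ?_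
    · simp [hxy, hl]
    · simp only [hl, List.headD_cons, Function.update_self, ne_eq, hxy.symm, not_false_eq_true,
        Function.update_of_ne, List.reverse_cons, List.append_assoc, List.cons_append,
        List.nil_append]
      ext i : 1
      by_cases hy : i = y
      · simp [hy]
      · by_cases hx : i = x <;> simp [hx, hy, hxy]
    · simp; omega

lemma move {x y z : ℕ} (hxy : x ≠ y) (hxz : x ≠ z) (hyz : y ≠ z) {s : Store} (hy : s y = [])
    (hz : s z = []) :
    Runs (.move x y z) s (8 * (s x).length + 2)
      (Function.update (Function.update s x []) y (s x)) := by
  refine ((revMove hxz s).seq (revMove hyz.symm _)).cast ?_ ?_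
  · ext i : 1
    by_cases h : i = y
    · subst h; simp [hyz, hxy.symm, hy, hz]
    · by_cases h' : i = z
      · subst h'; simp [hz, h, hxz.symm]
      · simp [h, h']
  · simp [hz]; omega

lemma copy {x y z : ℕ} (hxy : x ≠ y) (hxz : x ≠ z) (hyz : y ≠ z) {s : Store} (hy : s y = [])
    (hz : s z = []) :
    Runs (.copy x y z) s (10 * (s x).length + 2) (Function.update s y (s x)) := by
  -- The second loop drains the reversed copy in `z` onto `x` and `y` at once, which restores both
  -- `x` and the order.
  have key : ∀ (l : List Bool) (s : Store), s z = l →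
      Runs (.loop z (.seq (.pushTop z x) (.seq (.pushTop z y) (.pop z)))) s (6 * l.length + 1)
        (Function.update (Function.update (Function.update s z []) x (l.reverse ++ s x)) y
          (l.reverse ++ s y)) := by
    intro l
    induction l with
    | nil =>
      intro s hs
      have := Function.update_eq_self z s
      exact (loopDone hs).cast (by rw [hs] at this; simp [this]) (by simp)
    | cons b l ih =>
      intro s hs
      refine (loopStep (by simp [hs]) ((pushTop z x s).seq ((pushTop z y _).seq (pop z _)))
        (ih _ ?_)).cast ?_ ?_
      · simp [hyz.symm, hxz.symm, hs]
      · ext i : 1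
        by_cases h : i = y
        · subst h; simp [hyz, hxy.symm, hs, hxz.symm]
        · by_cases h' : i = x
          · subst h'; simp [hs, h, hxz]
          · by_cases h'' : i = z
            · subst h''; simp [h, h']
            · simp [h, h', h'']
      · simp; omega
  refine ((revMove hxz s).seq (key (s x).reverse _ (by simp [hz]))).cast ?_ ?_
  · ext i : 1
    by_cases h : i = y
    · subst h; simp [hyz, hxy.symm, hy]
    · by_cases h' : i = x
      · subst h'; simp [h, hxz]
      · by_cases h'' : i = z
        · subst h''; simp [h, h', hz]
        · simp [h, h', h'']
  · simp; omega

end Runs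

lemma eval_natPoly_mono (b : Polynomial ℕ) : Monotone fun n => b.eval n := by
  intro m n h
  simp only [Polynomial.eval_eq_sum_range]
  gcongr

/-! ### Closure properties of polynomial time -/

lemma polyTime_iff {k : ℕ} {f : (Fin k → List Bool) → List Bool} :
    PolyTime f ↔ ∃ (p : Prog) (b : Polynomial ℕ), ∀ x : Fin k → List Bool, ∃ s : Store,
      Runs p (inputStore x) (b.eval (∑ i, (x i).length)) s ∧ s 0 = f x := by
  constructor
  · rintro ⟨p, b, h⟩
    refine ⟨p, b, fun x => ?_⟩
    obtain ⟨t, s, e, ht, hs⟩ := h x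
    exact ⟨s, ⟨t, ht, e⟩, hs⟩
  · rintro ⟨p, b, h⟩
    refine ⟨p, b, fun x => ?_⟩
    obtain ⟨s, ⟨t, ht, e⟩, hs⟩ := h x
    exact ⟨t, s, e, ht, hs⟩

lemma inputStore_of_le {k : ℕ} {x : Fin k → List Bool} {j : ℕ} (h : k ≤ j) :
    inputStore x j = [] := dif_neg (by omega)

lemma length_inputStore_le {k : ℕ} (x : Fin k → List Bool) (j : ℕ) :
    (inputStore x j).length ≤ ∑ i, (x i).length := by
  unfold inputStore
  split_ifs with h
  · exact Finset.single_le_sum (f := fun i => (x i).length) (fun _ _ => Nat.zero_le _)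
      (Finset.mem_univ _)
  · simp

/-- The summand `X` accounts for what stack `0` contains at the start. -/
lemma PolyTime.length_le {k : ℕ} {f : (Fin k → List Bool) → List Bool} (hf : PolyTime f) :
    ∃ b : Polynomial ℕ, ∀ x, (f x).length ≤ b.eval (∑ i, (x i).length) := by
  obtain ⟨p, b, h⟩ := polyTime_iff.1 hf
  refine ⟨.X + b, fun x => ?_⟩
  obtain ⟨s, e, hs⟩ := h x
  have h₁ := e.length_le 0
  have h₂ := length_inputStore_le x 0
  simp only [Polynomial.eval_add, Polynomial.eval_X, ← hs]
  omega

/-- The stacks from `k + 2` on, arranged in banks. -/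
def bankStack (k b j : ℕ) : ℕ := k + 2 + Nat.pair b j

lemma le_bankStack (k b j : ℕ) : k ≤ bankStack k b j := by
  unfold bankStack; omega

lemma bankStack_inj {k b j b' j' : ℕ} : bankStack k b j = bankStack k b' j' ↔ b = b' ∧ j = j' := by
  simp [bankStack, Nat.pair_eq_pair]

lemma bankStack_ne {k b j i : ℕ} (h : i < k + 2) : bankStack k b j ≠ i := by
  unfold bankStack; omega

/-- Copying the first `n` stacks to a bank. -/
lemma exists_copyBank (k b n : ℕ) (hn : n ≤ k) : ∃ p : Prog, ∀ s : Store, s (k + 1) = [] →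
    (∀ j, s (bankStack k b j) = []) → ∀ N, (∀ j < k, (s j).length ≤ N) →
    ∃ s', Runs p s (n * (10 * N + 2) + 1) s' ∧
      (∀ j < n, s' (bankStack k b j) = s j) ∧
      ∀ i, (∀ j < n, i ≠ bankStack k b j) → s' i = s i := by
  induction n with
  | zero => exact ⟨.skip, fun s _ _ N _ => ⟨s, Runs.skip.mono (by omega), by simp⟩⟩
  | succ n ih =>
    obtain ⟨p, hp⟩ := ih (by omega)
    refine ⟨.seq p (.copy n (bankStack k b n) (k + 1)), fun s hz hs N hN => ?_⟩
    obtain ⟨s', e, h₁, h₂⟩ := hp s hz hs N hN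
    have hn' : s' n = s n := h₂ n fun j _ => (bankStack_ne (by omega)).symm
    refine ⟨_, (e.seq (Runs.copy (bankStack_ne (by omega)).symm (by omega)
      (bankStack_ne (by omega)) ?_ ?_)).mono ?_, ?_, ?_⟩
    · rw [h₂, hs]
      intro j hj e
      exact absurd (bankStack_inj.1 e).2 (by omega)
    · rw [h₂, hz]
      exact fun j _ => (bankStack_ne (by omega)).symm
    · have := hN n (by omega)
      rw [hn', add_mul]
      omega
    · intro j hj
      by_cases hjn : j = n
      · subst hjn; simp [hn']
      · rw [Function.update_of_ne (fun e => hjn (bankStack_inj.1 e).2), h₁ j (by omega)]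
    · intro i hi
      rw [Function.update_of_ne (hi n (by omega)), h₂ i fun j hj => hi j (by omega)]

/-- A program expects empty work stacks and may leave garbage, so `g n` gets a fresh bank `n + 1`
with a copy of the inputs, and its value is moved to stack `n` of bank `0`. In the end bank `0`
looks like the input store of the tuple of values. Stack `k + 1` is scratch space. -/
lemma exists_evalBank {k m : ℕ} {g : Fin m → (Fin k → List Bool) → List Bool}
    (hg : ∀ i, PolyTime (g i)) (n : ℕ) (hn : n ≤ m) : ∃ (p : Prog) (b : Polynomial ℕ),
    ∀ x : Fin k → List Bool, ∃ s : Store, Runs p (inputStore x) (b.eval (∑ i, (x i).length)) s ∧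
      (∀ j < k + 2, s j = inputStore x j) ∧
      (∀ j, s (bankStack k 0 j) = if h : j < n then g ⟨j, h.trans_le hn⟩ x else []) ∧
      ∀ i j, n < i → s (bankStack k i j) = [] := by
  induction n with
  | zero =>
    refine ⟨.skip, 1, fun x => ⟨inputStore x, Runs.skip.mono (by simp), fun _ _ => rfl, ?_, ?_⟩⟩
    · exact fun j => inputStore_of_le (le_bankStack k 0 j)
    · exact fun i j _ => inputStore_of_le (le_bankStack k i j)
  | succ n ih =>
    obtain ⟨p, b, hp⟩ := ih (by omega)
    obtain ⟨q, c, hq⟩ := polyTime_iff.1 (hg ⟨n, hn⟩)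
    obtain ⟨r, hr⟩ := exists_copyBank k (n + 1) k le_rfl
    refine ⟨.seq p (.seq r (.seq (q.map (bankStack k (n + 1)))
      (.move (bankStack k (n + 1) 0) (bankStack k 0 n) (k + 1)))),
      b + ((.C k * (10 * .X + 2) + 1) + (c + (8 * (.X + c) + 2))), fun x => ?_⟩
    set N := ∑ i, (x i).length with hN
    have tmp : inputStore x (k + 1) = [] := by simp [inputStore]
    obtain ⟨s₁, e₁, a₁, b₁, c₁⟩ := hp x
    obtain ⟨s₂, e₂, a₂, b₂⟩ := hr s₁ (by rw [a₁ _ (by omega), tmp])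
      (fun j => c₁ _ j (by omega)) N
      (fun j hj => by rw [a₁ j (by omega)]; exact length_inputStore_le x j)
    obtain ⟨s, e, hs⟩ := hq x
    rw [← hN] at e e₁
    obtain ⟨s₃, e₃, a₃, b₃⟩ := Runs.map (σ := bankStack k (n + 1)) (S := s₂)
      (fun i j h => (bankStack_inj.1 h).2) e (by
        intro j
        by_cases hj : j < k
        · rw [a₂ j hj, a₁ j (by omega)]
        · rw [b₂, c₁ _ _ (by omega)]
          · simp [inputStore, hj]
          · intro i hi h
            have := (bankStack_inj.1 h).2
            omega)
    have low : ∀ j < k + 2, s₃ j = inputStore x j := fun j hj => by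
      rw [b₃ j fun i => (bankStack_ne hj).symm, b₂ j fun i _ => (bankStack_ne hj).symm, a₁ j hj]
    have other : ∀ i j, i ≠ n + 1 → s₃ (bankStack k i j) = s₁ (bankStack k i j) := fun i j hi => by
      rw [b₃ _ fun j' h => hi (bankStack_inj.1 h).1, b₂ _ fun j' _ h => hi (bankStack_inj.1 h).1]
    have len : (s 0).length ≤ N + c.eval N :=
      (e.length_le 0).trans (by have := length_inputStore_le x 0; rw [← hN] at this; omega)
    have ne : bankStack k (n + 1) 0 ≠ bankStack k 0 n := fun h => by simp [bankStack_inj] at h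
    refine ⟨_, (e₁.seq (e₂.seq (e₃.seq (Runs.move ne (bankStack_ne (by omega))
      (bankStack_ne (by omega)) ?_ ?_)))).mono ?_, ?_, ?_, ?_⟩
    · rw [other _ _ (by omega), b₁]; simp
    · rw [low _ (by omega), tmp]
    · rw [a₃]
      simp
      omega
    · intro j hj
      rw [Function.update_of_ne (bankStack_ne hj).symm, Function.update_of_ne (bankStack_ne hj).symm,
        low j hj]
    · intro j
      by_cases hj : j = n
      · subst hj; simp [a₃, hs]
      · rw [Function.update_of_ne (by simp [bankStack_inj, hj]),
          Function.update_of_ne (by simp [bankStack_inj]), other _ _ (by omega), b₁]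
        have : j < n ↔ j < n + 1 := by omega
        simp [this]
    · intro i j hi
      rw [Function.update_of_ne (by simp [bankStack_inj]; omega),
        Function.update_of_ne (by simp [bankStack_inj]; omega), other _ _ (by omega),
        c₁ _ _ (by omega)]

/-- The program of `f`, relabelled to bank `0`, runs on the values prepared by `exists_evalBank`.
Its time is bounded in terms of the lengths of those values, which are polynomial by
`PolyTime.length_le`; polynomials over `ℕ` are monotone, so the bounds compose. -/
theorem PolyTime.comp {k m : ℕ} {f : (Fin m → List Bool) → List Bool}
    {g : Fin m → (Fin k → List Bool) → List Bool} (hf : PolyTime f) (hg : ∀ i, PolyTime (g i)) :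
    PolyTime fun x => f fun i => g i x := by
  obtain ⟨p, b, hp⟩ := exists_evalBank hg m le_rfl
  obtain ⟨q, c, hq⟩ := polyTime_iff.1 hf
  choose d hd using fun i => (hg i).length_le
  refine polyTime_iff.2 ⟨.seq p (.seq (q.map (bankStack k 0)) (.seq (.clear 0)
    (.move (bankStack k 0 0) 0 (k + 1)))),
    b + (c.comp (∑ i, d i) + ((2 * .X + 1) + (8 * ((∑ i, d i) + c.comp (∑ i, d i)) + 2))),
    fun x => ?_⟩
  set N := ∑ i, (x i).length with hN
  set D := (∑ i, d i).eval N with hD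
  obtain ⟨s₁, e₁, a₁, b₁, c₁⟩ := hp x
  rw [← hN] at e₁
  obtain ⟨s, e, hs⟩ := hq fun i => g i x
  have lenD : ∑ i, (g i x).length ≤ D := by
    rw [hD, Polynomial.eval_finsetSum]
    exact Finset.sum_le_sum fun i _ => hd i x
  replace e : Runs q _ (c.eval D) s := e.mono (eval_natPoly_mono c lenD)
  obtain ⟨s₂, e₂, a₂, b₂⟩ := Runs.map (σ := bankStack k 0) (S := s₁)
      (fun i j h => (bankStack_inj.1 h).2) e (by
        intro j
        rw [b₁]
        rfl)
  have low : ∀ j < k + 2, s₂ j = inputStore x j := fun j hj => by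
    rw [b₂ j fun i => (bankStack_ne hj).symm, a₁ j hj]
  have len₀ : (s₂ 0).length ≤ N := by
    rw [low 0 (by omega)]; exact length_inputStore_le x 0
  have len : (s 0).length ≤ D + c.eval D :=
    (e.length_le 0).trans (by have := length_inputStore_le (fun i => g i x) 0; omega)
  have ne : bankStack k 0 0 ≠ 0 := bankStack_ne (by omega)
  refine ⟨_, (e₁.seq (e₂.seq ((Runs.clear 0 s₂).seq (Runs.move ne (bankStack_ne (by omega))
    (by omega) ?_ ?_)))).mono ?_, ?_⟩
  · simp
  · rw [Function.update_of_ne (by omega), low _ (by omega)]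
    simp [inputStore]
  · rw [Function.update_of_ne ne, a₂]
    simp only [Polynomial.eval_add, Polynomial.eval_mul, Polynomial.eval_comp, Polynomial.eval_X,
      Polynomial.eval_ofNat, Polynomial.eval_one, ← hD]
    omega
  · rw [Function.update_self, Function.update_of_ne ne, a₂, hs]

/-! ### Basic polynomial-time functions -/

/-- The store with the given contents of the first four stacks. -/
def stk (a b c d : List Bool) : Store := fun
  | 0 => a
  | 1 => b
  | 2 => c
  | 3 => d
  | _ => []

section stk

variable (a b c d l : List Bool)

@[simp] lemma stk_zero : stk a b c d 0 = a := rfl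
@[simp] lemma stk_one : stk a b c d 1 = b := rfl
@[simp] lemma stk_two : stk a b c d 2 = c := rfl
@[simp] lemma stk_three : stk a b c d 3 = d := rfl

@[simp] lemma update_stk_zero : Function.update (stk a b c d) 0 l = stk l b c d := by
  funext i; match i with | 0 | 1 | 2 | 3 | (_ + 4) => rfl

@[simp] lemma update_stk_one : Function.update (stk a b c d) 1 l = stk a l c d := by
  funext i; match i with | 0 | 1 | 2 | 3 | (_ + 4) => rfl

@[simp] lemma update_stk_two : Function.update (stk a b c d) 2 l = stk a b l d := by
  funext i; match i with | 0 | 1 | 2 | 3 | (_ + 4) => rfl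

@[simp] lemma update_stk_three : Function.update (stk a b c d) 3 l = stk a b c l := by
  funext i; match i with | 0 | 1 | 2 | 3 | (_ + 4) => rfl

lemma inputStore_two (x : Fin 2 → List Bool) : inputStore x = stk (x 0) (x 1) [] [] := by
  funext i; match i with | 0 | 1 | 2 | 3 | (_ + 4) => rfl

lemma inputStore_one (x : Fin 1 → List Bool) : inputStore x = stk (x 0) [] [] [] := by
  funext i; match i with | 0 | 1 | 2 | 3 | (_ + 4) => rfl

end stk

lemma polyTime_one_of_runs {f : List Bool → List Bool} (p : Prog) (b : Polynomial ℕ)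
    (h : ∀ l, ∃ T s, Runs p (stk l [] [] []) T s ∧ T ≤ b.eval l.length ∧ s 0 = f l) :
    PolyTime fun x : Fin 1 → List Bool => f (x 0) := by
  refine polyTime_iff.2 ⟨p, b, fun x => ?_⟩
  obtain ⟨T, s, e, hT, hs⟩ := h (x 0)
  exact ⟨s, by rw [inputStore_one]; exact e.mono (by simpa using hT), hs⟩

lemma polyTime_two_of_runs {f : List Bool → List Bool → List Bool} (p : Prog) (b : Polynomial ℕ)
    (h : ∀ l m, ∃ T s, Runs p (stk l m [] []) T s ∧ T ≤ b.eval (l.length + m.length) ∧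
      s 0 = f l m) :
    PolyTime fun x : Fin 2 → List Bool => f (x 0) (x 1) := by
  refine polyTime_iff.2 ⟨p, b, fun x => ?_⟩
  obtain ⟨T, s, e, hT, hs⟩ := h (x 0) (x 1)
  exact ⟨s, by rw [inputStore_two]; exact e.mono (by simpa using hT), hs⟩

lemma polyTime_proj {k : ℕ} (i : Fin k) : PolyTime fun x : Fin k → List Bool => x i := by
  by_cases hi : (i : ℕ) = 0
  · refine polyTime_iff.2 ⟨.skip, 1, fun x => ⟨_, Runs.skip.mono (by simp), ?_⟩⟩
    simp [inputStore, ← hi]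
  · refine polyTime_iff.2 ⟨.seq (.clear 0) (.move i 0 k), (2 * .X + 1) + (8 * .X + 2), fun x =>
      ⟨_, ((Runs.clear 0 _).seq (Runs.move hi i.2.ne (by omega) (by simp) ?_)).mono ?_, ?_⟩⟩
    · rw [Function.update_of_ne (by omega), inputStore_of_le le_rfl]
    · rw [Function.update_of_ne hi]
      have h₁ := length_inputStore_le x 0
      have h₂ := length_inputStore_le x i
      simp only [Polynomial.eval_add, Polynomial.eval_mul, Polynomial.eval_X,
        Polynomial.eval_ofNat, Polynomial.eval_one]
      omega
    · simp [Function.update_of_ne hi, inputStore]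

lemma polyTime_const {k : ℕ} (l : List Bool) : PolyTime fun _ : Fin k → List Bool => l := by
  -- Without inputs stack `0` starts empty and the bits of `l` are just pushed; composition with the
  -- empty family gives any `k`.
  suffices PolyTime fun _ : Fin 0 → List Bool => l from
    this.comp (g := Fin.elim0) fun i => i.elim0
  have h0 : ∀ x : Fin 0 → List Bool, inputStore x = stk [] [] [] [] := fun x => by
    funext i; match i with | 0 | 1 | 2 | 3 | (_ + 4) => rfl
  suffices ∃ p, Runs p (stk [] [] [] []) (l.length + 1) (stk l [] [] []) by
    obtain ⟨p, hp⟩ := this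
    exact polyTime_iff.2 ⟨p, .C (l.length + 1), fun x => ⟨_, by simpa [h0] using hp, rfl⟩⟩
  induction l with
  | nil => exact ⟨.skip, .skip⟩
  | cons b l ih =>
    obtain ⟨p, hp⟩ := ih
    exact ⟨.seq p (.push 0 b), (hp.seq (.push 0 b _)).cast (by simp) (by simp)⟩

lemma polyTime_append : PolyTime fun x : Fin 2 → List Bool => x 0 ++ x 1 := by
  refine polyTime_two_of_runs (.seq (.revMove 0 2) (.seq (.revMove 1 3) (.seq (.revMove 3 0)
    (.revMove 2 0)))) (8 * .X + 4) fun a b => ⟨_, _,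
      (Runs.revMove (by decide) _).seq ((Runs.revMove (by decide) _).seq
        ((Runs.revMove (by decide) _).seq (Runs.revMove (by decide) _))), ?_, ?_⟩
  · simp; omega
  · simp

/-! ### Self-delimiting pairs -/

/-- The self-delimiting encoding of a pair of bit strings. -/
def pairStr (a b : List Bool) : List Bool := a.foldr (fun x l => true :: x :: l) (false :: b)

/-- The first component of an encoded pair. -/
def fstStr : List Bool → List Bool
  | true :: b :: l => b :: fstStr l
  | [true] => [false]
  | _ => []

/-- The second component of an encoded pair. -/
def sndStr : List Bool → List Bool
  | true :: _ :: l => sndStr l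
  | false :: l => l
  | _ => []

lemma fstStr_pairStr (a b : List Bool) : fstStr (pairStr a b) = a := by
  induction a with
  | nil => rfl
  | cons x a ih => exact congrArg (x :: ·) ih

lemma sndStr_pairStr (a b : List Bool) : sndStr (pairStr a b) = b := by
  induction a with
  | nil => rfl
  | cons x a ih => exact ih

lemma pairStr_append (a b c : List Bool) : pairStr a b ++ c = pairStr a (b ++ c) := by
  induction a with
  | nil => rfl
  | cons x a ih => simpa [pairStr] using ih

lemma length_pairStr (a b : List Bool) : (pairStr a b).length = 2 * a.length + 1 + b.length := by
  induction a with
  | nil => simp [pairStr]; omega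
  | cons x a ih => simp [pairStr] at ih ⊢; omega

lemma polyTime_pairStr : PolyTime fun x : Fin 2 → List Bool => pairStr (x 0) (x 1) := by
  have loop : ∀ c d a : List Bool,
      Runs (.loop 2 (.seq (.pushTop 2 0) (.seq (.push 0 true) (.pop 2)))) (stk a [] c d)
        (5 * c.length + 1) (stk (c.foldl (fun l x => true :: x :: l) a) [] [] d) := by
    intro c d
    induction c with
    | nil => exact fun a => (Runs.loopDone rfl).cast rfl (by simp)
    | cons x c ih =>
      intro a
      exact (Runs.loopStep (by simp) (((Runs.pushTop 2 0 _).seq ((Runs.push 0 true _).seq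
        (Runs.pop 2 _))).cast (by simp) le_rfl) (ih (true :: x :: a))).cast rfl
        (by simp; omega)
  refine polyTime_two_of_runs (.seq (.revMove 0 2) (.seq (.move 1 0 3) (.seq (.push 0 false)
    (.loop 2 (.seq (.pushTop 2 0) (.seq (.push 0 true) (.pop 2))))))) (17 * .X + 20) fun a b =>
      ⟨_, _, (Runs.revMove (by decide) _).seq ((Runs.move (by decide) (by decide) (by decide)
        (by simp) (by simp)).seq ((Runs.push 0 false _).seq (s'' := stk (pairStr a b) [] [] [])
          (T' := 5 * a.length + 1) ?_)), ?_, rfl⟩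
  · simpa [pairStr] using loop a.reverse [] (false :: b)
  · simp; omega

/-- Each round consumes a marker and a data bit; a `false` marker clears stack `0`, which ends the
loop. The value `[false]` on `[true]` is what `pushTop` produces from an exhausted stack. Two bits
go at a time, hence the induction on a length bound. -/
lemma polyTime_fstStr : PolyTime fun x : Fin 1 → List Bool => fstStr (x 0) := by
  have loop : ∀ (n : ℕ) (a c : List Bool), a.length ≤ n →
      Runs (.loop 0 (.ifTop 0 (.seq (.pop 0) (.seq (.pushTop 0 2) (.pop 0))) (.clear 0)))
        (stk a [] c []) (6 * n + 6) (stk [] [] ((fstStr a).reverse ++ c) []) := by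
    intro n
    induction n with
    | zero =>
      intro a c ha
      obtain rfl : a = [] := by simpa using ha
      exact (Runs.loopDone rfl).cast rfl (by simp)
    | succ n ih =>
      intro a c ha
      have step : ∀ l, a = true :: l → fstStr a = l.headD false :: fstStr l.tail →
          Runs (.loop 0 (.ifTop 0 (.seq (.pop 0) (.seq (.pushTop 0 2) (.pop 0))) (.clear 0)))
            (stk a [] c []) (6 * (n + 1) + 6) (stk [] [] ((fstStr a).reverse ++ c) []) := by
        rintro l rfl hl
        rw [hl]
        refine (Runs.loopStep (by simp) ((Runs.ifTop (fun _ => (Runs.pop 0 _).seq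
          ((Runs.pushTop 0 2 _).seq (Runs.pop 0 _))) (by simp)).cast (by simp) le_rfl)
          (ih l.tail (l.headD false :: c) ?_)).cast (by simp) (by omega)
        simp at ha ⊢; omega
      match a with
      | [] => exact (Runs.loopDone rfl).cast rfl (by simp)
      | false :: l =>
        refine (Runs.loopStep (by simp) (Runs.ifTop (T := 2 * n + 3) (s' := stk [] [] c [])
          (by simp) fun _ => ?_) (Runs.loopDone rfl)).cast rfl (by omega)
        exact (Runs.clear 0 _).cast (by simp) (by simp at ha ⊢; omega)
      | [true] => exact step _ rfl rfl
      | true :: x :: l => exact step _ rfl rfl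
  refine polyTime_one_of_runs (.seq (.loop 0 (.ifTop 0 (.seq (.pop 0) (.seq (.pushTop 0 2)
    (.pop 0))) (.clear 0))) (.revMove 2 0)) ((6 * .X + 6) + (4 * .X + 5)) fun a =>
      ⟨_, _, (loop a.length a [] le_rfl).seq (Runs.revMove (by decide) _), ?_, ?_⟩
  · have : ∀ (n : ℕ) (a : List Bool), a.length ≤ n → (fstStr a).length ≤ n := by
      intro n
      induction n with
      | zero =>
        intro a ha
        obtain rfl : a = [] := by simpa using ha
        simp [fstStr]
      | succ n ih =>
        intro a ha
        match a with
        | [] => simp [fstStr]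
        | false :: l => simp [fstStr]
        | [true] => simp [fstStr]
        | true :: x :: l => simpa [fstStr] using ih l (by simp at ha; omega)
    have := this _ a le_rfl
    simp; omega
  · simp

lemma polyTime_sndStr : PolyTime fun x : Fin 1 → List Bool => sndStr (x 0) := by
  have loop : ∀ (n : ℕ) (a : List Bool), a.length ≤ n → ∃ T ≤ 6 * n + 6,
      Runs (.loop 0 (.ifTop 0 (.seq (.pop 0) (.pop 0)) (.seq (.pop 0) (.revMove 0 1))))
        (stk a [] [] []) T (stk [] (sndStr a).reverse [] []) := by
    intro n
    induction n with
    | zero =>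
      intro a ha
      obtain rfl : a = [] := by simpa using ha
      exact ⟨1, by omega, Runs.loopDone rfl⟩
    | succ n ih =>
      intro a ha
      have step : ∀ l, a = true :: l → sndStr a = sndStr l.tail → ∃ T ≤ 6 * (n + 1) + 6,
          Runs (.loop 0 (.ifTop 0 (.seq (.pop 0) (.pop 0)) (.seq (.pop 0) (.revMove 0 1))))
            (stk a [] [] []) T (stk [] (sndStr a).reverse [] []) := by
        rintro l rfl hl
        rw [hl]
        obtain ⟨T, hT, e⟩ := ih l.tail (by simp at ha ⊢; omega)
        exact ⟨_, by omega, Runs.loopStep (by simp) ((Runs.ifTop (T := 2) (fun _ =>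
          (Runs.pop 0 _).seq (Runs.pop 0 _)) (by simp)).cast (by simp) le_rfl) e⟩
      match a with
      | [] => exact ⟨1, by omega, Runs.loopDone rfl⟩
      | false :: l =>
        refine ⟨_, ?_, Runs.loopStep (by simp) (Runs.ifTop (T := 4 * l.length + 2) (by simp)
          fun _ => ((Runs.pop 0 _).seq (Runs.revMove (by decide) _)).cast
            (s'' := stk [] l.reverse [] []) (by simp) ?_) (Runs.loopDone rfl)⟩
        · simp at ha; omega
        · simp; omega
      | [true] => exact step _ rfl rfl
      | true :: x :: l => exact step _ rfl rfl
  refine polyTime_one_of_runs (.seq (.loop 0 (.ifTop 0 (.seq (.pop 0) (.pop 0))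
    (.seq (.pop 0) (.revMove 0 1)))) (.revMove 1 0)) (.C 4 * (.X + (6 * .X + 6)) + 7 + 6 * .X)
      fun a => ?_
  obtain ⟨T, hT, e⟩ := loop a.length a le_rfl
  refine ⟨_, _, e.seq (Runs.revMove (by decide) _), ?_, ?_⟩
  -- The running time of the loop bounds the length of the second component.
  · have := e.length_le 1
    simp at this ⊢; omega
  · simp

/-! ### Bitwise masks, guards and unary arithmetic -/

/-- The string `s`, with `d` (padded by `false`) added bitwise. -/
def mask : List Bool → List Bool → List Bool
  | [], _ => []
  | a :: s, d => (a ^^ d.headD false) :: mask s d.tail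

@[simp] lemma length_mask (s d : List Bool) : (mask s d).length = s.length := by
  induction s generalizing d with
  | nil => rfl
  | cons a s ih => simp [mask, ih]

lemma mask_mask_self (s d : List Bool) : mask (mask s d) d = s := by
  induction s generalizing d with
  | nil => rfl
  | cons a s ih => simp [mask, ih]

/-- Here `s` cancels, leaving `d` cut or zero-padded to the length of `s`. Decryption removes the
pad this way, and `takeCoins` uses the same effect to extract a prefix. -/
lemma mask_mask (s d : List Bool) :
    mask s (mask s d) = d.take s.length ++ List.replicate (s.length - d.length) false := by
  induction s generalizing d with
  | nil => simp [mask]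
  | cons a s ih => cases d <;> simp [mask, ih, List.replicate_succ]

lemma polyTime_mask : PolyTime fun x : Fin 2 → List Bool => mask (x 0) (x 1) := by
  have loop : ∀ a b c : List Bool,
      Runs (.loop 0 (.seq (.ifTop 0 (.ifTop 1 (.push 2 false) (.push 2 true)) (.pushTop 1 2))
        (.seq (.pop 0) (.pop 1)))) (stk a b c []) (6 * a.length + 1)
          (stk [] (b.drop a.length) ((mask a b).reverse ++ c) []) := by
    intro a
    induction a with
    | nil => exact fun b c => (Runs.loopDone rfl).cast (by simp [mask]) (by simp)
    | cons x a ih =>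
      intro b c
      refine (Runs.loopStep (by simp) (((Runs.ifTop (T := 2)
        (s' := stk (x :: a) b ((x ^^ b.headD false) :: c) []) (fun h => ?_) fun h => ?_).seq
          ((Runs.pop 0 _).seq (Runs.pop 1 _))).cast (by simp) le_rfl)
          (ih b.tail ((x ^^ b.headD false) :: c))).cast ?_ ?_
      · obtain rfl : x = true := by simpa using h
        refine Runs.ifTop (fun h => ?_) fun h => ?_
        · exact (Runs.push 2 false _).cast (by cases b <;> simp_all) le_rfl
        · exact (Runs.push 2 true _).cast (by cases b <;> simp_all) le_rfl
      · obtain rfl : x = false := by simpa using h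
        exact (Runs.pushTop 1 2 _).cast (by simp) le_rfl
      · cases b <;> simp [mask]
      · simp; omega
  refine polyTime_two_of_runs (.seq (.loop 0 (.seq (.ifTop 0 (.ifTop 1 (.push 2 false)
    (.push 2 true)) (.pushTop 1 2)) (.seq (.pop 0) (.pop 1)))) (.revMove 2 0)) (10 * .X + 2)
      fun a b => ⟨_, _, (loop a b []).seq (Runs.revMove (by decide) _), ?_, ?_⟩
  · simp; omega
  · simp

lemma polyTime_drop : PolyTime fun x : Fin 2 → List Bool => (x 0).drop (x 1).length := by
  have loop : ∀ b a : List Bool, Runs (.loop 1 (.seq (.pop 1) (.pop 0))) (stk a b [] [])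
      (3 * b.length + 1) (stk (a.drop b.length) [] [] []) := by
    intro b
    induction b with
    | nil => exact fun a => (Runs.loopDone rfl).cast (by simp) (by simp)
    | cons x b ih =>
      intro a
      exact (Runs.loopStep (by simp) (((Runs.pop 1 _).seq (Runs.pop 0 _)).cast (by simp)
        le_rfl) (ih a.tail)).cast (by simp) (by simp; omega)
  exact polyTime_two_of_runs _ (3 * .X + 1) fun a b => ⟨_, _, loop b a, by simp, rfl⟩

/-- The string `b`, unless `a` is empty. -/
def guardStr (a b : List Bool) : List Bool := if a = [] then [] else b

/-- The loop serves as a conditional: its body empties stack `0`, so it runs at most once, and only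
then does the second input reach stack `2`. -/
lemma polyTime_guardStr : PolyTime fun x : Fin 2 → List Bool => guardStr (x 0) (x 1) := by
  refine polyTime_two_of_runs (.seq (.loop 0 (.seq (.clear 0) (.revMove 1 2))) (.revMove 2 0))
    (10 * .X + 10) fun a b => ?_
  by_cases ha : a = []
  · subst ha
    exact ⟨_, _, (Runs.loopDone rfl).seq (Runs.revMove (by decide) _), by simp,
      by simp [guardStr]⟩
  · refine ⟨_, _, (Runs.loopStep (s'' := stk [] [] b.reverse []) ha
      (((Runs.clear 0 _).seq (Runs.revMove (by decide) _)).cast (by simp) le_rfl)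
        (Runs.loopDone rfl)).seq (Runs.revMove (by decide) _), ?_, ?_⟩
    · simp; omega
    · simp [guardStr, ha]

/-- Each bit of stack `0` triggers one pass over stack `1`, counted on stack `3`; the pass parks the
bits on stack `2`, from where they are restored. -/
lemma polyTime_lenMul :
    PolyTime fun x : Fin 2 → List Bool => unary ((x 0).length * (x 1).length) := by
  have inner : ∀ b a c d : List Bool,
      Runs (.loop 1 (.seq (.pushTop 1 2) (.seq (.push 3 true) (.pop 1)))) (stk a b c d)
        (5 * b.length + 1) (stk a [] (b.reverse ++ c) (unary b.length ++ d)) := by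
    intro b
    induction b with
    | nil => exact fun a c d => (Runs.loopDone rfl).cast (by simp [unary]) (by simp)
    | cons x b ih =>
      intro a c d
      exact (Runs.loopStep (by simp) (((Runs.pushTop 1 2 _).seq ((Runs.push 3 true _).seq
        (Runs.pop 1 _))).cast (by simp) le_rfl) (ih a (x :: c) (true :: d))).cast
          (by simp [unary, List.replicate_succ']) (by simp; omega)
  have outer : ∀ a b d : List Bool,
      Runs (.loop 0 (.seq (.pop 0) (.seq (.loop 1 (.seq (.pushTop 1 2) (.seq (.push 3 true)
        (.pop 1)))) (.revMove 2 1)))) (stk a b [] d) (a.length * (9 * b.length + 10) + 1)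
          (stk [] b [] (unary (a.length * b.length) ++ d)) := by
    intro a
    induction a with
    | nil => exact fun b d => (Runs.loopDone rfl).cast (by simp [unary]) (by simp)
    | cons x a ih =>
      intro b d
      have body : Runs (.seq (.pop 0) (.seq (.loop 1 (.seq (.pushTop 1 2) (.seq (.push 3 true)
          (.pop 1)))) (.revMove 2 1))) (stk (x :: a) b [] d) (9 * b.length + 3)
          (stk a b [] (unary b.length ++ d)) := by
        refine ((Runs.pop 0 _).seq (((?_ : Runs _ _ (5 * b.length + 1) (stk a [] b.reverse
          (unary b.length ++ d)))).seq (Runs.revMove (x := 2) (y := 1) (by decide) _))).cast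
            (by simp) ?_
        · simpa using inner b a [] d
        · simp; omega
      refine (Runs.loopStep (by simp) body (ih b (unary b.length ++ d))).cast ?_ ?_
      · simp [unary, add_mul, ← List.append_assoc]
      · simp only [List.length_cons, add_mul]; omega
  refine polyTime_two_of_runs (f := fun a b => unary (a.length * b.length))
    (.seq (.loop 0 (.seq (.pop 0) (.seq (.loop 1 (.seq (.pushTop 1 2)
    (.seq (.push 3 true) (.pop 1)))) (.revMove 2 1)))) (.seq (.clear 0) (.revMove 3 0)))
      (.X * (9 * .X + 10) + (4 * (.X * .X) + 10)) fun a b => ⟨_, _, (outer a b []).seq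
        ((Runs.clear 0 _).seq (Runs.revMove (by decide) _)), ?_, ?_⟩
  · have : a.length * b.length ≤ (a.length + b.length) * (a.length + b.length) := by nlinarith
    have : a.length * (9 * b.length + 10) ≤
      (a.length + b.length) * (9 * (a.length + b.length) + 10) := by gcongr <;> omega
    simp [unary]; omega
  · simp [unary]

/-- In unary, concatenation is addition and `polyTime_lenMul` is multiplication, so induction on the
polynomial suffices. -/
lemma polyTime_unary_eval (P : Polynomial ℕ) :
    PolyTime fun x : Fin 1 → List Bool => unary (P.eval (x 0).length) := by
  have mul : ∀ f g : ℕ → ℕ, PolyTime (fun x : Fin 1 → List Bool => unary (f (x 0).length)) →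
      PolyTime (fun x : Fin 1 → List Bool => unary (g (x 0).length)) →
      PolyTime (fun x : Fin 1 → List Bool => unary (f (x 0).length * g (x 0).length)) := by
    intro f g hf hg
    have := polyTime_lenMul.comp (g := ![_, _]) (Fin.forall_fin_two.2 ⟨hf, hg⟩)
    simpa [unary] using this
  induction P using Polynomial.induction_on with
  | C a => simpa using polyTime_const (k := 1) (unary a)
  | add p q hp hq =>
    have := polyTime_append.comp (g := ![_, _]) (Fin.forall_fin_two.2 ⟨hp, hq⟩)
    simpa [unary] using this
  | monomial n a h =>
    have hX : PolyTime fun x : Fin 1 → List Bool => unary (x 0).length := by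
      have := polyTime_lenMul.comp (g := ![_, _]) (Fin.forall_fin_two.2
        ⟨polyTime_proj (0 : Fin 1), polyTime_const (k := 1) [true]⟩)
      simpa using this
    have := mul (fun m => (Polynomial.C a * Polynomial.X ^ n).eval m) (fun m => m) h hX
    simpa only [pow_succ, ← mul_assoc, Polynomial.eval_mul_X] using this

/-! ### Combinators for polynomial-time functions and algorithms -/

lemma PolyTime.comp₂ {k : ℕ} {F : List Bool → List Bool → List Bool}
    (hF : PolyTime fun x : Fin 2 → List Bool => F (x 0) (x 1))
    {f g : (Fin k → List Bool) → List Bool} (hf : PolyTime f) (hg : PolyTime g) :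
    PolyTime fun x => F (f x) (g x) :=
  hF.comp (g := ![f, g]) (Fin.forall_fin_two.2 ⟨hf, hg⟩)

lemma PolyTime.comp₁ {k : ℕ} {F : List Bool → List Bool}
    (hF : PolyTime fun x : Fin 1 → List Bool => F (x 0))
    {f : (Fin k → List Bool) → List Bool} (hf : PolyTime f) : PolyTime fun x => F (f x) :=
  hF.comp (g := fun _ => f) fun _ => hf

/-- The first part of the coins `l`, of length `P (|a|)`. -/
def takeCoins (P : Polynomial ℕ) (a l : List Bool) : List Bool :=
  mask (unary (P.eval a.length)) (mask (unary (P.eval a.length)) l)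

/-- The coins `l` after the first `P (|a|)`. -/
def dropCoins (P : Polynomial ℕ) (a l : List Bool) : List Bool := l.drop (P.eval a.length)

lemma takeCoins_append {P : Polynomial ℕ} {n : ℕ} {r : List Bool} (hr : r.length = P.eval n)
    (r' : List Bool) : takeCoins P (unary n) (r ++ r') = r := by
  simp [takeCoins, mask_mask, unary, ← hr]

lemma dropCoins_append {P : Polynomial ℕ} {n : ℕ} {r : List Bool} (hr : r.length = P.eval n)
    (r' : List Bool) : dropCoins P (unary n) (r ++ r') = r' := by
  simp [dropCoins, unary, ← hr]

namespace PolyFun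

variable {k m : ℕ}

/-- Composition. -/
def comp (f : PolyFun m) (g : Fin m → PolyFun k) : PolyFun k :=
  ⟨fun x => f fun i => g i x, f.polyTime.comp fun i => (g i).polyTime⟩

/-- The projections. -/
def proj (i : Fin k) : PolyFun k := ⟨fun x => x i, polyTime_proj i⟩

/-- The encoded pair of two values. -/
def pair (f g : PolyFun k) : PolyFun k :=
  ⟨fun x => pairStr (f x) (g x), polyTime_pairStr.comp₂ f.polyTime g.polyTime⟩

/-- The first component of an encoded pair. -/
def fst (f : PolyFun k) : PolyFun k := ⟨fun x => fstStr (f x), polyTime_fstStr.comp₁ f.polyTime⟩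

/-- The second component of an encoded pair. -/
def snd (f : PolyFun k) : PolyFun k := ⟨fun x => sndStr (f x), polyTime_sndStr.comp₁ f.polyTime⟩

/-- Encryption with a one-time pad. -/
def otp (f g : PolyFun k) : PolyFun k :=
  ⟨fun x => mask (f x) (pairStr (g x) []), polyTime_mask.comp₂ f.polyTime
    (polyTime_pairStr.comp₂ g.polyTime (polyTime_const []))⟩

/-- Bitwise addition. -/
def xor (f g : PolyFun k) : PolyFun k :=
  ⟨fun x => mask (f x) (g x), polyTime_mask.comp₂ f.polyTime g.polyTime⟩

/-- The value of `g`, unless that of `f` is empty. -/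
def guard (f g : PolyFun k) : PolyFun k :=
  ⟨fun x => guardStr (f x) (g x), polyTime_guardStr.comp₂ f.polyTime g.polyTime⟩

/-- The first part of the coins. -/
def take (P : Polynomial ℕ) (f g : PolyFun k) : PolyFun k :=
  ⟨fun x => takeCoins P (f x) (g x),
    have h := (polyTime_unary_eval P).comp₁ (F := fun l => unary (P.eval l.length)) f.polyTime
    polyTime_mask.comp₂ h (polyTime_mask.comp₂ h g.polyTime)⟩

/-- The second part of the coins. -/
def drop (P : Polynomial ℕ) (f g : PolyFun k) : PolyFun k :=
  ⟨fun x => dropCoins P (f x) (g x), by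
    have h := (polyTime_unary_eval P).comp₁ (F := fun l => unary (P.eval l.length)) f.polyTime
    have := polyTime_drop.comp₂ (F := fun a b => a.drop b.length) g.polyTime h
    simpa [dropCoins, unary] using this⟩

@[simp] lemma proj_apply (i : Fin k) (x : Fin k → List Bool) : proj i x = x i := rfl

@[simp] lemma pair_apply (f g : PolyFun k) (x : Fin k → List Bool) :
    pair f g x = pairStr (f x) (g x) := rfl

@[simp] lemma fst_apply (f : PolyFun k) (x : Fin k → List Bool) : fst f x = fstStr (f x) := rfl

@[simp] lemma snd_apply (f : PolyFun k) (x : Fin k → List Bool) : snd f x = sndStr (f x) := rfl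

@[simp] lemma otp_apply (f g : PolyFun k) (x : Fin k → List Bool) :
    otp f g x = mask (f x) (pairStr (g x) []) := rfl

@[simp] lemma xor_apply (f g : PolyFun k) (x : Fin k → List Bool) :
    xor f g x = mask (f x) (g x) := rfl

@[simp] lemma guard_apply (f g : PolyFun k) (x : Fin k → List Bool) :
    guard f g x = guardStr (f x) (g x) := rfl

@[simp] lemma take_apply (P : Polynomial ℕ) (f g : PolyFun k) (x : Fin k → List Bool) :
    take P f g x = takeCoins P (f x) (g x) := rfl

@[simp] lemma drop_apply (P : Polynomial ℕ) (f g : PolyFun k) (x : Fin k → List Bool) :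
    drop P f g x = dropCoins P (f x) (g x) := rfl

/-- The joint value of several functions. -/
def tuple (g : Fin m → PolyFun k) (x : Fin k → List Bool) : Fin m → List Bool := fun i => g i x

@[simp] lemma comp_apply (f : PolyFun m) (g : Fin m → PolyFun k) (x : Fin k → List Bool) :
    f.comp g x = f (tuple g x) := rfl

@[simp] lemma tuple_nil (x : Fin k → List Bool) : tuple ![] x = ![] := by
  funext i; exact i.elim0

@[simp] lemma tuple_cons (f : PolyFun k) (g : Fin m → PolyFun k) (x : Fin k → List Bool) :
    tuple (Matrix.vecCons f g) x = Matrix.vecCons (f x) (tuple g x) := by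
  funext i
  cases i using Fin.cases <;> rfl

end PolyFun

namespace QAlg

variable {k m : ℕ}

/-- The algorithm `A` on classical inputs that are computed from the given ones. -/
def comp (A : QAlg m) (g : Fin m → PolyFun k) : QAlg k where
  circ := A.circ.comp g
  meas := A.meas.comp g
  -- Argument `0` of the post-processing is the measurement outcome, so the classical inputs are
  -- shifted by one.
  post := A.post.comp (Matrix.vecCons (.proj 0) fun i => (g i).comp fun j => .proj j.succ)

lemma comp_post (A : QAlg m) (g : Fin m → PolyFun k) (y : List Bool) (x : Fin k → List Bool) :
    (A.comp g).post (Matrix.vecCons y x) = A.post (Matrix.vecCons y (PolyFun.tuple g x)) := by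
  simp only [comp, PolyFun.comp_apply, PolyFun.tuple_cons]
  rfl

lemma comp_circuit (A : QAlg m) (g : Fin m → PolyFun k) (x : Fin k → List Bool) (i : ℕ) :
    (A.comp g).circuit x i = A.circuit (PolyFun.tuple g x) i := rfl

lemma comp_output (A : QAlg m) (g : Fin m → PolyFun k) (x : Fin k → List Bool) (i : ℕ)
    (S : Finset Wire) : (A.comp g).output x i S = A.output (PolyFun.tuple g x) i S :=
  comp_post A g _ x

end QAlg

/-! ### Averages -/

section Averages

variable {n : ℕ} {f g : List Bool → ℝ}

lemma avgBits_congr (h : ∀ r, r.length = n → f r = g r) : avgBits n f = avgBits n g := by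
  unfold avgBits
  congr 1
  exact Finset.sum_congr rfl fun r _ => h _ (List.length_ofFn ..)

lemma avgBits_const (n : ℕ) (c : ℝ) : avgBits n (fun _ => c) = c := by
  simp [avgBits]

lemma avgBits_add (a b : ℕ) (f : List Bool → ℝ) :
    avgBits (a + b) f = avgBits a fun r => avgBits b fun r' => f (r ++ r') := by
  simp only [avgBits, ← Finset.sum_div, pow_add, div_div]
  rw [mul_comm (2 ^ b : ℝ), ← (Fin.appendEquiv a b).sum_comp, Fintype.sum_prod_type]
  simp [Fin.appendEquiv, List.ofFn_fin_append]

lemma avgBits_comm (a b : ℕ) (f : List Bool → List Bool → ℝ) :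
    (avgBits a fun r => avgBits b fun s => f r s) =
      avgBits b fun s => avgBits a fun r => f r s := by
  simp only [avgBits, ← Finset.sum_div]
  rw [Finset.sum_comm, div_right_comm]

lemma avgBits_avgOver_comm (a : ℕ) (M : Finset (List Bool)) (f : List Bool → List Bool → ℝ) :
    (avgBits a fun r => avgOver M fun s => f r s) =
      avgOver M fun s => avgBits a fun r => f r s := by
  simp only [avgBits, avgOver, ← Finset.sum_div]
  rw [Finset.sum_comm, div_right_comm]

/-- Masking with a fixed `d` is an involution on strings of length `n`, hence a permutation of them.
This is the perfect secrecy of the one-time pad. -/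
lemma avgBits_mask (n : ℕ) (d : List Bool) (f : List Bool → ℝ) :
    (avgBits n fun s => f (mask s d)) = avgBits n f := by
  let e : (Fin n → Bool) → Fin n → Bool := fun v i => (mask (List.ofFn v) d).get (i.cast (by simp))
  have he : ∀ v, List.ofFn (e v) = mask (List.ofFn v) d := fun v => by
    refine List.ext_get (by simp) fun i h₁ h₂ => ?_
    simp [e]
  have inv : Function.Involutive e := fun v =>
    List.ofFn_injective (by rw [he, he, mask_mask_self])
  unfold avgBits
  congr 1
  simpa [he] using Equiv.sum_comp inv.toPerm fun v => f (List.ofFn v)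

end Averages

/-! ### The scheme with identical keys -/

namespace UEScheme

variable (U : UEScheme) (ℓ : Polynomial ℕ)

/-- The inputs of the encryption algorithm of `U` in a run of that of `U.otp ℓ`. -/
def otpEncArgs : Fin 4 → PolyFun 4 :=
  ![.proj 0, U.ek.comp ![.proj 0, .take U.kgCoins (.proj 0) (.proj 3)], .proj 2,
    .drop U.kgCoins (.proj 0) (.proj 3)]

/-- The scheme in which the key is a one-time pad of length `ℓ n`. Encryption generates fresh keys
of `U`, encrypts with `U`, and appends the decryption key, encrypted with the one-time pad. -/
def otp : UEScheme where
  kgCoins := ℓ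
  ek := .proj 1
  dk := .proj 1
  encCoins := U.kgCoins + U.encCoins
  encStr := .pair (U.encStr.comp U.otpEncArgs)
    (.otp (.proj 1) (U.dk.comp ![.proj 0, .take U.kgCoins (.proj 0) (.proj 3)]))
  encCirc := U.encCirc.comp U.otpEncArgs
  dec := U.dec.comp ![.proj 0, .fst (.xor (.proj 1) (.snd (.proj 2))), .fst (.proj 2)]

variable {U ℓ} {n : ℕ} {r : List Bool}

lemma tuple_otpEncArgs (hr : r.length = U.kgCoins.eval n) (s m r' : List Bool) :
    PolyFun.tuple U.otpEncArgs ![unary n, s, m, r ++ r'] =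
      ![unary n, U.ek ![unary n, r], m, r'] := by
  simp [otpEncArgs, takeCoins_append hr, dropCoins_append hr]

lemma otp_encCirc (hr : r.length = U.kgCoins.eval n) (s m r' : List Bool) :
    (U.otp ℓ).encCirc ![unary n, s, m, r ++ r'] =
      U.encCirc ![unary n, U.ek ![unary n, r], m, r'] := by
  simp [otp, tuple_otpEncArgs hr]

lemma otp_encCircuit (hr : r.length = U.kgCoins.eval n) (s m r' : List Bool) (k : ℕ) :
    (U.otp ℓ).encCircuit ![unary n, s, m, r ++ r'] k =
      U.encCircuit ![unary n, U.ek ![unary n, r], m, r'] k := by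
  rw [encCircuit, otp_encCirc hr, encCircuit]

lemma otp_encStr (hr : r.length = U.kgCoins.eval n) (s m r' : List Bool) :
    (U.otp ℓ).encStr ![unary n, s, m, r ++ r'] =
      pairStr (U.encStr ![unary n, U.ek ![unary n, r], m, r'])
        (mask s (pairStr (U.dk ![unary n, r]) [])) := by
  simp [otp, tuple_otpEncArgs hr, takeCoins_append hr]

lemma otp_ek (s : List Bool) : (U.otp ℓ).ek ![unary n, s] = s := rfl

lemma otp_dk (s : List Bool) : (U.otp ℓ).dk ![unary n, s] = s := rfl

/-- Unmasking yields the code of `d` followed by zeros; the code is self-delimiting, so the zeros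
are ignored. -/
lemma fstStr_mask_mask {s d : List Bool} (h : 2 * d.length + 1 ≤ s.length) :
    fstStr (mask s (mask s (pairStr d []))) = d := by
  rw [mask_mask, List.take_of_length_le (by simpa [length_pairStr] using h), pairStr_append,
    fstStr_pairStr]

/-- The one-time pad is long enough. -/
def PadLength (U : UEScheme) (ℓ : Polynomial ℕ) : Prop :=
  ∀ (n : ℕ) (r : List Bool), r.length = U.kgCoins.eval n →
    2 * (U.dk ![unary n, r]).length + 1 ≤ ℓ.eval n

/-- Key generation is polynomial-time in inputs of total length `n + kgCoins n`, so its keys are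
polynomially short. Doubling and adding one pays for the self-delimiting code. -/
lemma exists_padLength (U : UEScheme) : ∃ ℓ : Polynomial ℕ, U.PadLength ℓ := by
  obtain ⟨b, hb⟩ := U.dk.polyTime.length_le
  refine ⟨2 * b.comp (.X + U.kgCoins) + 1, fun n r hr => ?_⟩
  have := hb ![unary n, r]
  simp only [Fin.sum_univ_two, Matrix.cons_val_zero, Matrix.cons_val_one, hr, unary,
    List.length_replicate] at this
  simp only [Polynomial.eval_add, Polynomial.eval_mul, Polynomial.eval_comp, Polynomial.eval_X,
    Polynomial.eval_ofNat, Polynomial.eval_one]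
  exact Nat.add_le_add_right (Nat.mul_le_mul_left 2 this) 1

lemma otp_decArgs (h : U.PadLength ℓ) (hr : r.length = U.kgCoins.eval n) {s : List Bool}
    (hs : s.length = ℓ.eval n) (c : List Bool) :
    PolyFun.tuple ![.proj 0, .fst (.xor (.proj 1) (.snd (.proj 2))), .fst (.proj 2)]
      ![unary n, s, pairStr c (mask s (pairStr (U.dk ![unary n, r]) []))] =
      ![unary n, U.dk ![unary n, r], c] := by
  simp [fstStr_pairStr, sndStr_pairStr, fstStr_mask_mask ((h n r hr).trans_eq hs.symm)]

/-- For every single pad, averaging over the coins `r ++ r'` replays key generation and encryption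
of `U`, and decryption recovers the right key. The average over pads is then that of a constant. -/
lemma otp_decProb (h : U.PadLength ℓ) (n : ℕ) (m : List Bool) :
    (U.otp ℓ).decProb n m = U.decProb n m := by
  have key : ∀ s : List Bool, s.length = ℓ.eval n →
      (avgBits ((U.otp ℓ).encCoins.eval n) fun ρ =>
        let x := ![unary n, (U.otp ℓ).ek ![unary n, s], m, ρ]
        let z := ![unary n, (U.otp ℓ).dk ![unary n, s], (U.otp ℓ).encStr x]
        bornProb (((U.otp ℓ).encCircuit x 1 ++ (U.otp ℓ).dec.circuit z 1).act (zeroState Wire))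
          (fun S => (U.otp ℓ).dec.output z 1 S = m)) = U.decProb n m := by
    intro s hs
    have : (U.otp ℓ).encCoins.eval n = U.kgCoins.eval n + U.encCoins.eval n :=
      Polynomial.eval_add
    rw [this, avgBits_add]
    refine avgBits_congr fun r hr => avgBits_congr fun r' _ => ?_
    simp only [otp_ek, otp_dk, otp_encCircuit hr, otp_encStr hr]
    simp only [otp, QAlg.comp_circuit, QAlg.comp_output, otp_decArgs h hr hs]
  exact (avgBits_congr key).trans (avgBits_const _ _)

lemma otp_isUE {M : ℕ → Finset (List Bool)} (h : U.PadLength ℓ) (hU : U.IsUE M) :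
    (U.otp ℓ).IsUE M := by
  refine ⟨?_, fun n s m ρ hs hm hρ => ?_⟩
  · obtain ⟨ν, hν, hc⟩ := hU.correct
    exact ⟨ν, hν, fun n m hm => (hc n m hm).trans_eq (otp_decProb h n m).symm⟩
  · have hρ' : ρ.length = U.kgCoins.eval n + U.encCoins.eval n := hρ.trans Polynomial.eval_add
    have hr : (ρ.take (U.kgCoins.eval n)).length = U.kgCoins.eval n := by simp; omega
    rw [← List.take_append_drop (U.kgCoins.eval n) ρ, otp_encCirc hr]
    exact hU.classicallyDetermined n _ m _ hr hm (by simp; omega)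

end UEScheme

/-! ### The reduction -/

namespace Adversary

variable (A : Adversary) (ℓ : Polynomial ℕ)

/-- The inputs of the splitting procedures of `A` in a run of `A.reduce ℓ`. -/
def reduceArgs : Fin 4 → PolyFun 4 :=
  ![.proj 0, .take A.coins (.proj 0) (.proj 1), .proj 2,
    -- If no copy is requested, the experiment gives the empty string as classical part; the
    -- simulated pair must vanish as well.
    .guard (A.copies.comp ![.proj 0, .take A.coins (.proj 0) (.proj 1), .proj 2])
      (.pair (.proj 3) (.drop A.coins (.proj 0) (.proj 1)))]

/-- The adversary against `U` built from an adversary against `U.otp ℓ`. The encryption of the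
decryption key with the one-time pad is chosen uniformly at random; the one-time pad is computed
from it by the parties `Aᵢ`, who know the decryption key. -/
def reduce : Adversary where
  coins := A.coins + ℓ
  start := A.start.comp ![.proj 0, .take A.coins (.proj 0) (.proj 1)]
  copies := A.copies.comp ![.proj 0, .take A.coins (.proj 0) (.proj 1), .proj 2]
  splitCirc := A.splitCirc.comp A.reduceArgs
  splitStr := .pair (A.splitStr.comp A.reduceArgs) (.drop A.coins (.proj 0) (.proj 1))
  guess := A.guess.comp ![.proj 0, .proj 1, .otp (.snd (.proj 3)) (.proj 2), .fst (.proj 3)]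

variable {A ℓ} {n : ℕ} {u : List Bool}

lemma tuple_reduceArgs (hu : u.length = A.coins.eval n) (p o c : List Bool) :
    PolyFun.tuple A.reduceArgs ![unary n, u ++ p, o, c] =
      ![unary n, u, o, guardStr (A.copies ![unary n, u, o]) (pairStr c p)] := by
  simp [reduceArgs, takeCoins_append hu, dropCoins_append hu]

lemma reduce_copies (hu : u.length = A.coins.eval n) (p o : List Bool) :
    (A.reduce ℓ).copies ![unary n, u ++ p, o] = A.copies ![unary n, u, o] := by
  simp [reduce, takeCoins_append hu]

lemma reduce_splitCirc (hu : u.length = A.coins.eval n) (p o c : List Bool) :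
    (A.reduce ℓ).splitCirc ![unary n, u ++ p, o, c] =
      A.splitCirc ![unary n, u, o, guardStr (A.copies ![unary n, u, o]) (pairStr c p)] := by
  simp [reduce, tuple_reduceArgs hu]

lemma reduce_splitStr (hu : u.length = A.coins.eval n) (p o c : List Bool) :
    (A.reduce ℓ).splitStr ![unary n, u ++ p, o, c] = pairStr
      (A.splitStr ![unary n, u, o, guardStr (A.copies ![unary n, u, o]) (pairStr c p)]) p := by
  simp [reduce, tuple_reduceArgs hu, dropCoins_append hu]

/-- The parties turn the simulated masked key `p` and the decryption key `d` into the pad that `A`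
expects as its key. -/
lemma reduce_guessArgs (a b d t p : List Bool) :
    PolyFun.tuple ![.proj 0, .proj 1, .otp (.snd (.proj 3)) (.proj 2), .fst (.proj 3)]
      ![a, b, d, pairStr t p] = ![a, b, mask p (pairStr d []), t] := by
  simp [fstStr_pairStr, sndStr_pairStr]

/-- A run of `A₀` up to the choice of the number of copies, with output `o`, and then of the
circuit `C o`, followed by a measurement in which the event `E o` is tested. -/
def startProb {k : ℕ} (A : QAlg k) (x : Fin k → List Bool) (C : List Bool → Circuit Wire)
    (E : List Bool → Finset Wire → Prop) : ℝ :=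
  ∑ y : Fin (A.meas x).length → Bool,
    bornProb ((C (A.post (Matrix.vecCons (List.ofFn y) x))).act fun S =>
      if readBank 0 (A.meas x).length S = List.ofFn y then
        (A.circuit x 0).act (zeroState Wire) S else 0)
      (E (A.post (Matrix.vecCons (List.ofFn y) x)))

/-- The range of the sum depends on the number of measured qubits. Isolating the first stage in
`startProb` allows its inputs to be replaced without rewriting inside that dependent type. -/
lemma startProb_comp {k l : ℕ} (A : QAlg l) (g : Fin l → PolyFun k) (x : Fin k → List Bool)
    (C : List Bool → Circuit Wire) (E : List Bool → Finset Wire → Prop) :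
    startProb (A.comp g) x C E = startProb A (PolyFun.tuple g x) C E := by
  simp only [startProb, QAlg.comp_post]
  rfl

end Adversary

/-! ### Equality of the two security experiments -/

namespace UEScheme

variable {U : UEScheme} {ℓ : Polynomial ℕ}

/-- The circuit of the experiment after the choice of the number of copies, if `A₀` obtained
`o`. -/
def runCircuit (U : UEScheme) (A : Adversary) (n : ℕ) (r m r' u o : List Bool) : Circuit Wire :=
  let x := ![unary n, U.ek ![unary n, r], m, r']
  let q := (A.copies ![unary n, u, o]).length
  let z := ![unary n, u, o, if q = 0 then [] else U.encStr x]
  (List.range q).flatMap (fun k => U.encCircuit x (k + 1)) ++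
    ((readCircuit (A.splitCirc z)).map bankWire ++
    (List.range (q + 1)).flatMap (fun i => A.guess.circuit
      ![unary n, unary (i + 1), U.dk ![unary n, r], A.splitStr z] (i + 1)))

/-- The event that all the guesses are right. -/
def runEvent (U : UEScheme) (A : Adversary) (n : ℕ) (r m r' u o : List Bool) (S : Finset Wire) :
    Prop :=
  let x := ![unary n, U.ek ![unary n, r], m, r']
  let q := (A.copies ![unary n, u, o]).length
  let z := ![unary n, u, o, if q = 0 then [] else U.encStr x]
  ∀ i < q + 1, A.guess.output
    ![unary n, unary (i + 1), U.dk ![unary n, r], A.splitStr z] (i + 1) S = m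

lemma runProb_eq (U : UEScheme) (A : Adversary) (n : ℕ) (r m r' u : List Bool) :
    U.runProb A n r m r' u = Adversary.startProb A.start ![unary n, u]
      (U.runCircuit A n r m r' u) (U.runEvent A n r m r' u) := rfl

lemma guardStr_pairStr (a c p : List Bool) :
    guardStr a (pairStr (if a.length = 0 then [] else c) p) =
      if a.length = 0 then [] else pairStr c p := by
  by_cases h : a = [] <;> simp [guardStr, h]

/-- If the pad is `p` plus the encoded decryption key, then the masked key in the ciphertext is `p`
itself, by `mask_mask_self`. So for fixed coins both experiments run the same circuits and test the
same event. -/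
lemma otp_runProb {A : Adversary} {n : ℕ} {r u : List Bool} (hr : r.length = U.kgCoins.eval n)
    (hu : u.length = A.coins.eval n) (p m r' : List Bool) :
    (U.otp ℓ).runProb A n (mask p (pairStr (U.dk ![unary n, r]) [])) m (r ++ r') u =
      U.runProb (A.reduce ℓ) n r m r' (u ++ p) := by
  have hC : (U.otp ℓ).runCircuit A n (mask p (pairStr (U.dk ![unary n, r]) [])) m (r ++ r') u =
      U.runCircuit (A.reduce ℓ) n r m r' (u ++ p) := by
    funext o
    simp only [runCircuit, otp_ek, otp_dk, otp_encCircuit hr, otp_encStr hr, mask_mask_self,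
      Adversary.reduce_copies hu, Adversary.reduce_splitCirc hu, Adversary.reduce_splitStr hu,
      guardStr_pairStr]
    simp only [Adversary.reduce, QAlg.comp_circuit, Adversary.reduce_guessArgs]
  have hE : (U.otp ℓ).runEvent A n (mask p (pairStr (U.dk ![unary n, r]) [])) m (r ++ r') u =
      U.runEvent (A.reduce ℓ) n r m r' (u ++ p) := by
    funext o S
    simp only [runEvent, otp_ek, otp_dk, otp_encStr hr, mask_mask_self,
      Adversary.reduce_copies hu, Adversary.reduce_splitStr hu, guardStr_pairStr]
    simp only [Adversary.reduce, QAlg.comp_output, Adversary.reduce_guessArgs]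
  have hstart : (A.reduce ℓ).start =
    A.start.comp ![.proj 0, .take A.coins (.proj 0) (.proj 1)] := rfl
  rw [runProb_eq, runProb_eq, hC, hE, hstart, Adversary.startProb_comp]
  simp [takeCoins_append hu]

/-- Reordering the averages and substituting the masked key for the pad turns one experiment into
the other, by `otp_runProb`. -/
lemma otp_advantage (M : ℕ → Finset (List Bool)) (A : Adversary) (n : ℕ) :
    (U.otp ℓ).advantage M A n = U.advantage M (A.reduce ℓ) n := by
  have h₁ : (U.otp ℓ).encCoins.eval n = U.kgCoins.eval n + U.encCoins.eval n :=
    Polynomial.eval_add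
  have h₂ : (A.reduce ℓ).coins.eval n = A.coins.eval n + ℓ.eval n := Polynomial.eval_add
  have h₃ : (U.otp ℓ).kgCoins = ℓ := rfl
  simp only [advantage, h₁, h₂, h₃, avgBits_add]
  calc
    _ = avgBits (U.kgCoins.eval n) fun r => avgBits (ℓ.eval n) fun s => avgOver (M n) fun m =>
          avgBits (U.encCoins.eval n) fun r' => avgBits (A.coins.eval n) fun u =>
            (U.otp ℓ).runProb A n s m (r ++ r') u := by
      rw [avgBits_comm]
      simp only [avgBits_avgOver_comm]
    _ = avgBits (U.kgCoins.eval n) fun r => avgBits (ℓ.eval n) fun p => avgOver (M n) fun m =>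
          avgBits (U.encCoins.eval n) fun r' => avgBits (A.coins.eval n) fun u =>
            U.runProb (A.reduce ℓ) n r m r' (u ++ p) := by
      refine avgBits_congr fun r hr => ?_
      -- The substitution depends on the decryption key, so the average over `r` had to be moved
      -- outside that over the pad.
      rw [← avgBits_mask _ (pairStr (U.dk ![unary n, r]) [])]
      refine avgBits_congr fun p _ => congrArg (avgOver (M n)) (funext fun m => ?_)
      exact avgBits_congr fun r' _ => avgBits_congr fun u hu => otp_runProb hr hu p m r'
    _ = _ := by
      refine avgBits_congr fun r _ => ?_
      rw [avgBits_avgOver_comm]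
      refine congrArg (avgOver (M n)) (funext fun m => ?_)
      rw [avgBits_comm]
      exact avgBits_congr fun r' _ => avgBits_comm _ _ _

end UEScheme

end UnclonableEnc

end

theorem theoremA1 (M : ℕ → Finset (List Bool)) (hM : ∀ n, (M n).Nonempty)
    (U : UnclonableEnc.UEScheme) (hU : U.IsUE M) (hsec : U.MultiCopySearchSecure M) :
    ∃ U' : UnclonableEnc.UEScheme,
      U'.IsUE M ∧ U'.MultiCopySearchSecure M ∧ U'.IdenticalKeys := by
  obtain ⟨ℓ, hℓ⟩ := U.exists_padLength
  refine ⟨U.otp ℓ, UnclonableEnc.UEScheme.otp_isUE hℓ hU, fun A => ?_, fun _ _ _ => rfl⟩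
  obtain ⟨ν, hν, h⟩ := hsec (A.reduce ℓ)
  exact ⟨ν, hν, fun n => (UnclonableEnc.UEScheme.otp_advantage M A n).trans_le (h n)⟩
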